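/- Let $M$ be a (Hausdorff) smooth manifold and $(A,[\cdot,\cdot]_A,\rho)$ a Lie algebroid over $M$ (a smooth real vector bundle of finite rank $A\to M$ with anchor $\rho:A\to TM$ and a Lie bracket on $\Gamma(A)$ satisfying $[X,fY]_A=f[X,Y]_A+(\rho(X)f)\,Y$). For $f\in C^\infty(M)$ let $d_Af\in\Gamma(A^*)$ be $\langle d_Af,X\rangle=\rho(X)f$. For a bivector $\pi\in\Gamma(\wedge^2A)$ put $\pi^\sharp\alpha=i_\alpha\pi$, so that $\pi(\alpha,\beta)=\langle\beta,\pi^\sharp\alpha\rangle$, and $$[\alpha,\beta]_\pi=\mathcal L_{\pi^\sharp\alpha}\beta-\mathcal L_{\pi^\sharp\beta}\alpha-d_A(\pi(\alpha,\beta)),\qquad d_\pi f=[\pi,f]_A=-\pi^\sharp(d_Af)\in\Gamma(A).$$ Assume that $(A,\pi,N)$ is a Poisson–Nijenhuis Lie algebroid, that is: * $\pi\in\Gamma(\wedge^2A)$ is a Poisson structure, $[\pi,\pi]_A=0$; * $N:A\to A$ is a bundle map over the identity of $M$ that is a Nijenhuis operator: $N[X,Y]_N=[NX,NY]_A$ for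 all $X,Y\in\Gamma(A)$, where $[X,Y]_N=[NX,Y]_A+[X,NY]_A-N[X,Y]_A$; * $N$ and $\pi$ are compatible: $N\circ\pi^\sharp=\pi^\sharp\circ N^*$, so that $N\pi$ (given by $(N\pi)^\sharp=N\circ\pi^\sharp$) is a bivector, and $[\alpha,\beta]_{N\pi}=[N^*\alpha,\beta]_\pi+[\alpha,N^*\beta]_\pi-N^*[\alpha,\beta]_\pi$ for all $\alpha,\beta\in\Gamma(A^*)$. For $j\ge 0$ let $N^j\pi$ be the bivector with $(N^j\pi)^\sharp=N^j\circ\pi^\sharp$, for $i\ge1$ let $h_i=\frac1i\operatorname{Tr}N^i\in C^\infty(M)$, and let $X_{(N,\pi)}=d_\pi(\operatorname{Tr}N)\in\Gamma(A)$ be the modular vector field of $(A,\pi,N)$. Then the vector fields $X^k_{(N,\pi)}:=N^{k-1}X_{(N,\pi)}$, $k\ge1$, satisfy, for all integers $1\le i\le k$, $$X^k_{(N,\pi)}=N^{k-1}X_{(N,\pi)}=d_{N^{k-i}\pi}h_i=d_{N^{i-1}\pi}h_{k-i+1}.$$ -/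

import Mathlib

open Bundle
open scoped Manifold ContDiff Topology

namespace PNAlgebroids

section Smoothness

variable {m : ℕ} {M : Type*} [TopologicalSpace M] [ChartedSpace (EuclideanSpace ℝ (Fin m)) M]
  [IsManifold (𝓡 m) ∞ M]
  {F₁ : Type*} [NormedAddCommGroup F₁] [NormedSpace ℝ F₁]
  {E₁ : M → Type*} [TopologicalSpace (TotalSpace F₁ E₁)] [∀ x, TopologicalSpace (E₁ x)]
  [∀ x, AddCommGroup (E₁ x)] [∀ x, Module ℝ (E₁ x)] [∀ x, IsTopologicalAddGroup (E₁ x)]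
  [∀ x, ContinuousSMul ℝ (E₁ x)] [FiberBundle F₁ E₁] [VectorBundle ℝ F₁ E₁]
  [ContMDiffVectorBundle ∞ F₁ E₁ (𝓡 m)]
  {F₂ : Type*} [NormedAddCommGroup F₂] [NormedSpace ℝ F₂]
  {E₂ : M → Type*} [TopologicalSpace (TotalSpace F₂ E₂)] [∀ x, TopologicalSpace (E₂ x)]
  [∀ x, AddCommGroup (E₂ x)] [∀ x, Module ℝ (E₂ x)] [∀ x, IsTopologicalAddGroup (E₂ x)]
  [∀ x, ContinuousSMul ℝ (E₂ x)] [FiberBundle F₂ E₂] [VectorBundle ℝ F₂ E₂]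
  [ContMDiffVectorBundle ∞ F₂ E₂ (𝓡 m)]
  {F₃ : Type*} [NormedAddCommGroup F₃] [NormedSpace ℝ F₃]
  {E₃ : M → Type*} [TopologicalSpace (TotalSpace F₃ E₃)] [∀ x, TopologicalSpace (E₃ x)]
  [∀ x, AddCommGroup (E₃ x)] [∀ x, Module ℝ (E₃ x)] [∀ x, IsTopologicalAddGroup (E₃ x)]
  [∀ x, ContinuousSMul ℝ (E₃ x)] [FiberBundle F₃ E₃] [VectorBundle ℝ F₃ E₃]
  [ContMDiffVectorBundle ∞ F₃ E₃ (𝓡 m)]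

theorem contMDiff_hom_comp {ψ : ∀ x, E₂ x →L[ℝ] E₃ x} {φ : ∀ x, E₁ x →L[ℝ] E₂ x}
    (hψ : ContMDiff (𝓡 m) ((𝓡 m).prod 𝓘(ℝ, F₂ →L[ℝ] F₃)) ∞
      (fun x => TotalSpace.mk' (F₂ →L[ℝ] F₃) (E := fun x => E₂ x →L[ℝ] E₃ x) x (ψ x)))
    (hφ : ContMDiff (𝓡 m) ((𝓡 m).prod 𝓘(ℝ, F₁ →L[ℝ] F₂)) ∞
      (fun x => TotalSpace.mk' (F₁ →L[ℝ] F₂) (E := fun x => E₁ x →L[ℝ] E₂ x) x (φ x))) :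
    ContMDiff (𝓡 m) ((𝓡 m).prod 𝓘(ℝ, F₁ →L[ℝ] F₃)) ∞
      (fun x => TotalSpace.mk' (F₁ →L[ℝ] F₃) (E := fun x => E₁ x →L[ℝ] E₃ x) x
        ((ψ x).comp (φ x))) := by
  intro x₀
  have h1 := (contMDiffAt_hom_bundle _).1 (hψ x₀)
  have h2 := (contMDiffAt_hom_bundle _).1 (hφ x₀)
  refine (contMDiffAt_hom_bundle _).2 ⟨contMDiffAt_id, ?_⟩
  refine (h1.2.clm_comp h2.2).congr_of_eventuallyEq ?_
  filter_upwards [(trivializationAt F₂ E₂ x₀).open_baseSet.mem_nhds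
    (FiberBundle.mem_baseSet_trivializationAt' x₀)] with x hx
  ext v
  have h3 := (trivializationAt F₂ E₂ x₀).symmL_continuousLinearMapAt (R := ℝ) hx
    (φ x ((trivializationAt F₁ E₁ x₀).symmL ℝ x v))
  exact (congrArg (fun w => (trivializationAt F₃ E₃ x₀).continuousLinearMapAt ℝ x (ψ x w)) h3).symm

theorem contMDiff_hom_apply {φ : ∀ x, E₁ x →L[ℝ] ℝ} {v : ∀ x, E₁ x}
    (hφ : ContMDiff (𝓡 m) ((𝓡 m).prod 𝓘(ℝ, F₁ →L[ℝ] ℝ)) ∞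
      (fun x => TotalSpace.mk' (F₁ →L[ℝ] ℝ) (E := fun x => E₁ x →L[ℝ] ℝ) x (φ x)))
    (hv : ContMDiff (𝓡 m) ((𝓡 m).prod 𝓘(ℝ, F₁)) ∞ (fun x => TotalSpace.mk' F₁ x (v x))) :
    ContMDiff (𝓡 m) 𝓘(ℝ) ∞ (fun x => φ x (v x)) := by
  have : ContMDiff (𝓡 m) ((𝓡 m).prod 𝓘(ℝ)) ∞
      (fun x => TotalSpace.mk' ℝ (E := Bundle.Trivial M ℝ) x (φ x (v x))) :=
    ContMDiff.clm_bundle_apply (F₁ := F₁) (F₂ := ℝ) (b := id) hφ hv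
  intro x
  have := this x
  simp only [contMDiffAt_totalSpace] at this
  exact this.2

theorem contMDiff_mvfderiv_section {f : M → ℝ} (hf : ContMDiff (𝓡 m) 𝓘(ℝ) ∞ f) :
    ContMDiff (𝓡 m) ((𝓡 m).prod 𝓘(ℝ, EuclideanSpace ℝ (Fin m) →L[ℝ] ℝ)) ∞
      (fun x => TotalSpace.mk' (EuclideanSpace ℝ (Fin m) →L[ℝ] ℝ)
        (E := fun x => TangentSpace (𝓡 m) x →L[ℝ] ℝ) x (mvfderiv (𝓡 m) f x)) := by
  intro x₀
  refine (contMDiffAt_hom_bundle (E₂ := Bundle.Trivial M ℝ) _).2 ⟨contMDiffAt_id, ?_⟩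
  have := (hf x₀).mfderiv_const (m := ∞) (by simp)
  refine this.congr_of_eventuallyEq ?_
  filter_upwards with x
  ext v
  simp [inTangentCoordinates, ContinuousLinearMap.inCoordinates, mvfderiv]
  rfl

theorem contMDiff_trace [FiniteDimensional ℝ F₁] {T : ∀ x, E₁ x →L[ℝ] E₁ x}
    (hT : ContMDiff (𝓡 m) ((𝓡 m).prod 𝓘(ℝ, F₁ →L[ℝ] F₁)) ∞
      (fun x => TotalSpace.mk' (F₁ →L[ℝ] F₁) (E := fun x => E₁ x →L[ℝ] E₁ x) x (T x))) :
    ContMDiff (𝓡 m) 𝓘(ℝ) ∞ (fun x => LinearMap.trace ℝ (E₁ x) (T x : E₁ x →ₗ[ℝ] E₁ x)) := by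
  intro x₀
  have h := ((contMDiffAt_hom_bundle _).1 (hT x₀)).2
  let τ : (F₁ →L[ℝ] F₁) →L[ℝ] ℝ :=
    LinearMap.toContinuousLinearMap
      ((LinearMap.trace ℝ F₁) ∘ₗ (ContinuousLinearMap.coeLM ℝ : (F₁ →L[ℝ] F₁) →ₗ[ℝ] _))
  refine (τ.contMDiff.contMDiffAt.comp x₀ h).congr_of_eventuallyEq ?_
  filter_upwards [(trivializationAt F₁ E₁ x₀).open_baseSet.mem_nhds
    (FiberBundle.mem_baseSet_trivializationAt' x₀)] with x hx
  let e := ((trivializationAt F₁ E₁ x₀).continuousLinearEquivAt ℝ x hx).toLinearEquiv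
  have := LinearMap.trace_conj' (T x : E₁ x →ₗ[ℝ] E₁ x) e
  rw [← this]
  simp only [Function.comp, τ]
  change _ = LinearMap.trace ℝ F₁ _
  congr 1
  ext v
  simp [ContinuousLinearMap.inCoordinates_eq hx hx, e, LinearEquiv.conj_apply]

end Smoothness

noncomputable section

variable (m : ℕ) {M : Type*} [TopologicalSpace M] [ChartedSpace (EuclideanSpace ℝ (Fin m)) M]
  [IsManifold (𝓡 m) ∞ M]
  (F : Type*) [NormedAddCommGroup F] [NormedSpace ℝ F]
  (A : M → Type*) [TopologicalSpace (TotalSpace F A)] [∀ x, TopologicalSpace (A x)]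
  [∀ x, AddCommGroup (A x)] [∀ x, Module ℝ (A x)] [∀ x, IsTopologicalAddGroup (A x)]
  [∀ x, ContinuousSMul ℝ (A x)] [FiberBundle F A] [VectorBundle ℝ F A]
  [ContMDiffVectorBundle ∞ F A (𝓡 m)]

/-- The space `Γ(A)` of smooth sections of the vector bundle `A → M` (the `A`-vector fields). -/
abbrev Sec := Cₛ^∞⟮𝓡 m; F, A⟯

/-- The space `Ω¹(A) = Γ(A*)` of smooth sections of the dual bundle (the `A`-forms of degree 1). -/
abbrev Form := Cₛ^∞⟮𝓡 m; F →L[ℝ] ℝ, fun x => A x →L[ℝ] ℝ⟯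

/-- Smooth bundle maps `A → A` over the identity. -/
abbrev BundleEnd := Cₛ^∞⟮𝓡 m; F →L[ℝ] F, fun x => A x →L[ℝ] A x⟯

/-- Smooth bundle maps `A → TM` over the identity. -/
abbrev AnchorMap := Cₛ^∞⟮𝓡 m; F →L[ℝ] EuclideanSpace ℝ (Fin m),
  fun x => A x →L[ℝ] TangentSpace (𝓡 m) x⟯

/-- Smooth bundle maps `A* → A` over the identity. -/
abbrev DualMap := Cₛ^∞⟮𝓡 m; (F →L[ℝ] ℝ) →L[ℝ] F, fun x => (A x →L[ℝ] ℝ) →L[ℝ] A x⟯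

variable {m F A}

/-- The product `f X` of a smooth function and a section. -/
def smulSec (f : C^∞⟮𝓡 m, M; ℝ⟯) (X : Sec m F A) : Sec m F A :=
  ⟨fun x => f x • X x, f.contMDiff.smul_section X.contMDiff⟩

/-- The pairing `⟨α, X⟩` of an `A`-form of degree 1 and a section of `A`. -/
def pair (α : Form m F A) (X : Sec m F A) : C^∞⟮𝓡 m, M; ℝ⟯ :=
  ⟨fun x => α x (X x), contMDiff_hom_apply α.contMDiff X.contMDiff⟩

/-- The `A`-form `d_A f = ρ* df` determined by an anchor `ρ`. -/
def diffAux (ρ : AnchorMap m F A) (f : C^∞⟮𝓡 m, M; ℝ⟯) : Form m F A :=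
  ⟨fun x => (mvfderiv (𝓡 m) f x).comp (ρ x),
    contMDiff_hom_comp (E₃ := Bundle.Trivial M ℝ) (contMDiff_mvfderiv_section f.contMDiff)
      ρ.contMDiff⟩

/-- The map induced on sections by a bundle map `A → A`. -/
def BundleEnd.app (N : BundleEnd m F A) (X : Sec m F A) : Sec m F A :=
  ⟨fun x => N x (X x), ContMDiff.clm_bundle_apply (b := id) N.contMDiff X.contMDiff⟩

/-- The map `α ↦ N* α = α ∘ N` induced on sections of `A*` by the transpose of `N`. -/
def BundleEnd.transpose (N : BundleEnd m F A) (α : Form m F A) : Form m F A :=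
  ⟨fun x => (α x).comp (N x),
    contMDiff_hom_comp (E₃ := Bundle.Trivial M ℝ) α.contMDiff N.contMDiff⟩

/-- The map induced on sections by a bundle map `A* → A`. -/
def DualMap.app (P : DualMap m F A) (α : Form m F A) : Sec m F A :=
  ⟨fun x => P x (α x), ContMDiff.clm_bundle_apply (b := id) P.contMDiff α.contMDiff⟩

/-- The composition `N ∘ P : A* → A`. -/
def BundleEnd.compDual (N : BundleEnd m F A) (P : DualMap m F A) : DualMap m F A :=
  ⟨fun x => (N x).comp (P x), contMDiff_hom_comp N.contMDiff P.contMDiff⟩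

theorem contMDiff_id_section :
    ContMDiff (𝓡 m) ((𝓡 m).prod 𝓘(ℝ, F →L[ℝ] F)) ∞
      (fun x => TotalSpace.mk' (F →L[ℝ] F) (E := fun x => A x →L[ℝ] A x) x
        (ContinuousLinearMap.id ℝ (A x))) := by
  intro x₀
  refine (contMDiffAt_hom_bundle _).2 ⟨contMDiffAt_id, ?_⟩
  refine (contMDiffAt_const (c := ContinuousLinearMap.id ℝ F)).congr_of_eventuallyEq ?_
  filter_upwards [(trivializationAt F A x₀).open_baseSet.mem_nhds
    (FiberBundle.mem_baseSet_trivializationAt' x₀)] with x hx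
  ext v
  exact (trivializationAt F A x₀).continuousLinearMapAt_symmL (R := ℝ) hx v

/-- The power `N ^ k` of a bundle map. -/
def BundleEnd.pow (N : BundleEnd m F A) (k : ℕ) : BundleEnd m F A :=
  ⟨fun x => N x ^ k, by
    induction k with
    | zero => exact contMDiff_id_section
    | succ k ih => exact contMDiff_hom_comp ih N.contMDiff⟩

/-- The fibrewise trace `Tr N`. -/
def BundleEnd.trace [FiniteDimensional ℝ F] (N : BundleEnd m F A) : C^∞⟮𝓡 m, M; ℝ⟯ :=
  ⟨fun x => LinearMap.trace ℝ (A x) (N x : A x →ₗ[ℝ] A x), contMDiff_trace N.contMDiff⟩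

variable (m F A) in
/-- A Lie algebroid structure on the smooth vector bundle `A → M`: a bundle map `ρ : A → TM` (the
anchor) and a Lie bracket on `Γ(A)` such that `[X, f Y] = f [X, Y] + (ρ(X) f) Y`. -/
structure LieAlgebroid where
  /-- the anchor `ρ : A → TM` -/
  anchor : AnchorMap m F A
  /-- the Lie bracket of sections -/
  bracket : Sec m F A →ₗ[ℝ] Sec m F A →ₗ[ℝ] Sec m F A
  bracket_self : ∀ X, bracket X X = 0
  jacobi : ∀ X Y Z,
    bracket X (bracket Y Z) + bracket Y (bracket Z X) + bracket Z (bracket X Y) = 0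
  leibniz : ∀ (X Y : Sec m F A) (f : C^∞⟮𝓡 m, M; ℝ⟯),
    bracket X (smulSec f Y) = smulSec f (bracket X Y) + smulSec (pair (diffAux anchor f) X) Y

variable (m F A) in
/-- A bivector `π ∈ Γ(∧² A)`, given by the associated bundle map `π♯ : A* → A`, which is
skew-symmetric; `π(α, β) = ⟨β, π♯ α⟩`. -/
structure Bivector where
  /-- the bundle map `π♯ : A* → A` -/
  sharp : DualMap m F A
  skew : ∀ (x : M) (α β : A x →L[ℝ] ℝ), β (sharp x α) = -α (sharp x β)

/-- The function `π(α, β) = ⟨β, π♯ α⟩`. -/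
def Bivector.eval (P : Bivector m F A) (α β : Form m F A) : C^∞⟮𝓡 m, M; ℝ⟯ :=
  pair β (P.sharp.app α)

namespace LieAlgebroid

variable (L : LieAlgebroid m F A)

/-- The differential `d_A f ∈ Γ(A*)` of a function, `⟨d_A f, X⟩ = ρ(X) f`. -/
def diff (f : C^∞⟮𝓡 m, M; ℝ⟯) : Form m F A := diffAux L.anchor f

/-- The function `ρ(X) f`. -/
def act (X : Sec m F A) (f : C^∞⟮𝓡 m, M; ℝ⟯) : C^∞⟮𝓡 m, M; ℝ⟯ := pair (L.diff f) X

/-- The Lie derivative `𝓛_X α = d_A i_X α + i_X d_A α` of an `A`-form of degree 1, evaluated on a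
section `Y`: it is `ρ(Y) α(X) + d_A α (X, Y)`, where
`d_A α (X, Y) = ρ(X) α(Y) - ρ(Y) α(X) - α([X, Y])`. -/
def lieForm (X : Sec m F A) (α : Form m F A) (Y : Sec m F A) : C^∞⟮𝓡 m, M; ℝ⟯ :=
  L.act Y (pair α X) + (L.act X (pair α Y) - L.act Y (pair α X) - pair α (L.bracket X Y))

/-- The bracket `[α, β]_π = 𝓛_{π♯α} β - 𝓛_{π♯β} α - d_A (π(α, β))` on `Γ(A*)` determined by a
bivector, evaluated on a section `Y` of `A`. -/
def cobracket (P : Bivector m F A) (α β : Form m F A) (Y : Sec m F A) : C^∞⟮𝓡 m, M; ℝ⟯ :=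
  L.lieForm (P.sharp.app α) β Y - L.lieForm (P.sharp.app β) α Y - L.act Y (P.eval α β)

/-- The Schouten bracket `[π, π]_A ∈ Γ(∧³ A)` of a bivector with itself, evaluated on three
`A`-forms. It is computed as `d_π π`, where `d_π = [π, · ]_A` is given by the Koszul formula for the
bracket `[ , ]_π` and the anchor `ρ ∘ π♯` on `A*`; that is, it is the cyclic sum over `α, β, γ` of
`ρ(π♯α) (π(β, γ)) - π([α, β]_π, γ)`, and here `-π([α, β]_π, γ) = ⟨[α, β]_π, π♯γ⟩` by skewness. -/
def schoutenSelf (P : Bivector m F A) (α β γ : Form m F A) : C^∞⟮𝓡 m, M; ℝ⟯ :=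
  (L.act (P.sharp.app α) (P.eval β γ) + L.cobracket P α β (P.sharp.app γ))
    + (L.act (P.sharp.app β) (P.eval γ α) + L.cobracket P β γ (P.sharp.app α))
    + (L.act (P.sharp.app γ) (P.eval α β) + L.cobracket P γ α (P.sharp.app β))

/-- `π` is a Poisson structure on the Lie algebroid: `[π, π]_A = 0`. -/
def IsPoisson (P : Bivector m F A) : Prop :=
  ∀ α β γ : Form m F A, L.schoutenSelf P α β γ = 0

/-- The deformed bracket `[X, Y]_N = [NX, Y] + [X, NY] - N[X, Y]`. -/
def deformedBracket (N : BundleEnd m F A) (X Y : Sec m F A) : Sec m F A :=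
  L.bracket (N.app X) Y + L.bracket X (N.app Y) - N.app (L.bracket X Y)

/-- `N` is a Nijenhuis operator: its torsion `N[X, Y]_N - [NX, NY]` vanishes. -/
def IsNijenhuis (N : BundleEnd m F A) : Prop :=
  ∀ X Y : Sec m F A, N.app (L.deformedBracket N X Y) - L.bracket (N.app X) (N.app Y) = 0

/-- The deformation along `N*` of the bracket `[ , ]_π` on `Γ(A*)`,
`[α, β]_{N*} = [N*α, β]_π + [α, N*β]_π - N*[α, β]_π`, evaluated on a section `Y` of `A`. -/
def deformedCobracket (P : Bivector m F A) (N : BundleEnd m F A) (α β : Form m F A)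
    (Y : Sec m F A) : C^∞⟮𝓡 m, M; ℝ⟯ :=
  L.cobracket P (N.transpose α) β Y + L.cobracket P α (N.transpose β) Y
    - L.cobracket P α β (N.app Y)

/-- The `A`-vector field `d_π f = [π, f]_A = -π♯ (d_A f)`. -/
def dPoisson (P : Bivector m F A) (f : C^∞⟮𝓡 m, M; ℝ⟯) : Sec m F A :=
  -P.sharp.app (L.diff f)

/-- `d_π f` is the differential of `f` for the Lie algebroid `(A*, [ , ]_π, ρ ∘ π♯)`:
`⟨α, d_π f⟩ = ρ(π♯ α) f`. -/
theorem pair_dPoisson (P : Bivector m F A) (f : C^∞⟮𝓡 m, M; ℝ⟯) (α : Form m F A) :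
    pair α (L.dPoisson P f) = L.act (P.sharp.app α) f := by
  ext x
  have h := P.skew x (α x) (L.diff f x)
  change α x (-(P.sharp x (L.diff f x))) = L.diff f x (P.sharp x (α x))
  rw [map_neg, h]

end LieAlgebroid

/-- If `N ∘ π♯ = π♯ ∘ N*`, then `N^k ∘ π♯` is skew-symmetric, so that it defines a bivector
`N^k π`. -/
def Bivector.twist (P : Bivector m F A) (N : BundleEnd m F A)
    (h : ∀ (x : M) (α : A x →L[ℝ] ℝ), N x (P.sharp x α) = P.sharp x (α.comp (N x))) (k : ℕ) :
    Bivector m F A where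
  sharp := (N.pow k).compDual P.sharp
  skew := by
    have hk : ∀ (k : ℕ) (x : M) (α : A x →L[ℝ] ℝ),
        (N x ^ k) (P.sharp x α) = P.sharp x (α.comp (N x ^ k)) := by
      intro k x
      induction k with
      | zero => intro α; rfl
      | succ k ih =>
        intro α
        rw [pow_succ]
        change (N x ^ k) (N x (P.sharp x α)) = _
        rw [h, ih, ← pow_succ, pow_succ']
        rfl
    intro x α β
    change β ((N x ^ k) (P.sharp x α)) = -α ((N x ^ k) (P.sharp x β))
    rw [hk k x β]
    exact P.skew x α (β.comp (N x ^ k))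

variable (m F A) in
/-- A Poisson-Nijenhuis Lie algebroid `(A, π, N)`: a Lie algebroid with a Poisson structure `π` and
a Nijenhuis operator `N` that are compatible. Compatibility means that `Nπ`, with
`(Nπ)♯ = N ∘ π♯`, is a bivector (equivalently `N ∘ π♯ = π♯ ∘ N*`) and that the brackets
`[ , ]_{Nπ}` and `[ , ]_{N*}` on `Γ(A*)` coincide. -/
structure PNAlgebroid extends LieAlgebroid m F A where
  /-- the Poisson structure `π` -/
  poisson : Bivector m F A
  isPoisson : toLieAlgebroid.IsPoisson poisson
  /-- the Nijenhuis operator `N` -/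
  nijenhuis : BundleEnd m F A
  isNijenhuis : toLieAlgebroid.IsNijenhuis nijenhuis
  twist_skew : ∀ (x : M) (α : A x →L[ℝ] ℝ),
    nijenhuis x (poisson.sharp x α) = poisson.sharp x (α.comp (nijenhuis x))
  bracket_compat : ∀ (α β : Form m F A) (Y : Sec m F A),
    toLieAlgebroid.cobracket (poisson.twist nijenhuis twist_skew 1) α β Y =
      toLieAlgebroid.deformedCobracket poisson nijenhuis α β Y

namespace PNAlgebroid

variable (S : PNAlgebroid m F A)

/-- The bivector `N^k π`. -/
def twistedPoisson (k : ℕ) : Bivector m F A := S.poisson.twist S.nijenhuis S.twist_skew k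

variable [FiniteDimensional ℝ F]

/-- The function `h_i = (1 / i) Tr (N^i)`, for `i ≥ 1`. -/
def hamiltonian (i : ℕ) : C^∞⟮𝓡 m, M; ℝ⟯ := (1 / (i : ℝ)) • (S.nijenhuis.pow i).trace

/-- The modular vector field `X_{(N, π)} = d_π (Tr N)`. -/
def modularVectorField : Sec m F A :=
  S.toLieAlgebroid.dPoisson S.poisson S.nijenhuis.trace

/-- The vector field `X^k_{(N, π)} = N^{k - 1} X_{(N, π)}`, for `k ≥ 1`. -/
def hierarchy (k : ℕ) : Sec m F A := (S.nijenhuis.pow (k - 1)).app S.modularVectorField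

end PNAlgebroid

end

end PNAlgebroids

/-! Everything rests on the recursion `d_A h_{i+1} = N* d_A h_i` for `i ≥ 1`. Vanishing torsion says
`𝓛_{NX} N = N ∘ 𝓛_X N`. Since `ρ(X) h_{i+1} = Tr(Nⁱ 𝓛_X N)`, multiplying by `Nⁱ⁻¹` and taking traces
gives `ρ(NX) h_i = ρ(X) h_{i+1}`.

The trace formula is checked in a local frame: if `a` is the matrix of `N` and `g` that of `[X, ·]`
on the frame, then `𝓛_X N` has matrix `ρ(X)a + ga - ag`, and the commutator disappears in the trace
against a power of `a`. This is `IsNijenhuis.act_trace_pow`.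

Iterating from `h_1 = Tr N` gives `d_A h_{i+1} = (N*)ⁱ d_A Tr N`, and `N π♯ = π♯ N*` lets powers of
`N` pass through `π♯`, from the bivector onto the Hamiltonian. -/

namespace PNAlgebroids

/-! ### Derivations and traces of matrix powers -/

section MatrixDerivation

variable {S R ι : Type*} [CommSemiring S] [CommRing R] [Algebra S R] [Fintype ι]

theorem map_derivation_mul (D : Derivation S R R) (a b : Matrix ι ι R) :
    (a * b).map D = a.map D * b + a * b.map D := by
  ext i j
  simp only [Matrix.map_apply, Matrix.mul_apply, Matrix.add_apply, map_sum, Derivation.leibniz,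
    smul_eq_mul, ← Finset.sum_add_distrib]
  exact Finset.sum_congr rfl fun k _ => by ring

/-- The commuting factor `b` is there for the induction: by the Leibniz rule and cyclicity of the
trace, the last factor `a` of the power is absorbed into `b`. -/
theorem trace_mul_map_derivation_pow [DecidableEq ι] (D : Derivation S R R) (a : Matrix ι ι R)
    (k : ℕ) : ∀ b : Matrix ι ι R, Commute b a →
      (b * (a ^ (k + 1)).map D).trace = (k + 1 : R) * (b * a ^ k * a.map D).trace := by
  induction k with
  | zero => intro b _; simp
  | succ k ih =>
    intro b hb
    have h1 : (b * ((a ^ (k + 1)).map D * a)).trace = ((b * a) * (a ^ (k + 1)).map D).trace := by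
      rw [← Matrix.mul_assoc, Matrix.trace_mul_comm, ← Matrix.mul_assoc, hb.eq]
    rw [pow_succ, map_derivation_mul, Matrix.mul_add, Matrix.trace_add, h1,
      ih (b * a) (hb.mul_left (Commute.refl a)), Matrix.mul_assoc b a, ← pow_succ',
      ← Matrix.mul_assoc b]
    push_cast
    ring

/-- A derivation satisfies `D (tr aᵏ⁺¹) = (k + 1) tr (aᵏ D a)`. -/
theorem derivation_trace_pow [DecidableEq ι] (D : Derivation S R R) (a : Matrix ι ι R) (k : ℕ) :
    D (a ^ (k + 1)).trace = (k + 1 : R) * (a ^ k * a.map D).trace := by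
  have h := trace_mul_map_derivation_pow D a k 1 (Commute.one_left a)
  rw [Matrix.one_mul, Matrix.one_mul] at h
  rw [← h]
  simp [Matrix.trace, map_sum]

end MatrixDerivation

noncomputable section

variable {m : ℕ} {M : Type*} [TopologicalSpace M] [ChartedSpace (EuclideanSpace ℝ (Fin m)) M]
  [IsManifold (𝓡 m) ∞ M]

/-! ### Cutoff functions and local frames -/

theorem exists_cutoff [T2Space M] {x₀ : M} {U : Set M} (hU : U ∈ 𝓝 x₀) :
    ∃ χ : C^∞⟮𝓡 m, M; ℝ⟯, tsupport χ ⊆ U ∧ ∀ᶠ x in 𝓝 x₀, χ x = 1 := by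
  obtain ⟨f, -, hf⟩ := (SmoothBumpFunction.nhds_basis_tsupport (I := 𝓡 m) x₀).mem_iff.1 hU
  exact ⟨⟨f, f.contMDiff⟩, hf, f.eventuallyEq_one⟩

variable {F : Type*} [NormedAddCommGroup F] [NormedSpace ℝ F]
  {A : M → Type*} [TopologicalSpace (TotalSpace F A)] [∀ x, TopologicalSpace (A x)]
  [∀ x, AddCommGroup (A x)] [∀ x, Module ℝ (A x)] [∀ x, IsTopologicalAddGroup (A x)]
  [∀ x, ContinuousSMul ℝ (A x)] [FiberBundle F A] [VectorBundle ℝ F A]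
  [ContMDiffVectorBundle ∞ F A (𝓡 m)]

variable (m F A) in
/-- Near every point there is a frame of global sections, whose coefficients are given by global
smooth functions. -/
theorem exists_frame [T2Space M] [FiniteDimensional ℝ F] (x₀ : M) :
    ∃ (e : Fin (Module.finrank ℝ F) → Sec m F A)
      (c : Fin (Module.finrank ℝ F) → Sec m F A → C^∞⟮𝓡 m, M; ℝ⟯),
      ∀ᶠ x in 𝓝 x₀, ∃ B : Module.Basis (Fin (Module.finrank ℝ F)) ℝ (A x),
        (∀ i, B i = e i x) ∧ ∀ i X, c i X x = B.repr (X x) i := by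
  have : ContMDiffVectorBundle 1 F A (𝓡 m) := ContMDiffVectorBundle.of_le (n := ∞) (by simp)
  let t := trivializationAt F A x₀
  let b := Module.finBasis ℝ F
  have ht : t.baseSet ∈ 𝓝 x₀ :=
    t.open_baseSet.mem_nhds (FiberBundle.mem_baseSet_trivializationAt' x₀)
  -- The local frame and its coefficient functions, multiplied by `χ`, extend smoothly by zero; near
  -- `x₀`, where `χ = 1`, they are unchanged.
  obtain ⟨χ, hχ, hχ1⟩ := exists_cutoff (m := m) ht
  refine ⟨fun i => ⟨fun x => χ x • t.localFrame b i x, ?_⟩,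
    fun i X => ⟨fun x => χ x • t.localFrameCoeff (𝓡 m) b i x (X x), ?_⟩, ?_⟩
  · exact ContMDiffOn.smul_section_of_tsupport χ.contMDiff.contMDiffOn t.open_baseSet hχ
      (t.contMDiffOn_localFrame_baseSet ∞ b i)
  · refine contMDiff_of_tsupport fun x hx => ?_
    have hx' : x ∈ t.baseSet := hχ (tsupport_smul_subset_left _ _ hx)
    exact χ.contMDiff.contMDiffAt.smul
      (contMDiffAt_localFrameCoeff b hx' X.contMDiff.contMDiffAt i)
  · filter_upwards [ht, hχ1] with x hx h1
    refine ⟨t.basisAt b hx, fun i => ?_, fun i X => ?_⟩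
    · change _ = χ x • t.localFrame b i x
      rw [h1, one_smul, t.localFrame_apply_of_mem_baseSet b hx]
    · change χ x • t.localFrameCoeff (𝓡 m) b i x (X x) = _
      rw [h1, one_smul, t.localFrameCoeff_apply_of_mem_baseSet b hx]

/-! ### Locality of the anchor action and the bracket -/

namespace LieAlgebroid

variable (L : LieAlgebroid m F A)

/-- The derivation `f ↦ ρ(X) f` of `C^∞(M)`. -/
def actDerivation (X : Sec m F A) : Derivation ℝ C^∞⟮𝓡 m, M; ℝ⟯ C^∞⟮𝓡 m, M; ℝ⟯ :=
  Derivation.mk'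
    { toFun := L.act X
      map_add' := fun f g => by
        ext x
        have hf := f.contMDiff.mdifferentiable (by simp) x
        have hg := g.contMDiff.mdifferentiable (by simp) x
        exact DFunLike.congr_fun (mvfderiv_add hf hg) (L.anchor x (X x))
      map_smul' := fun r f => by
        ext x
        have hf := f.contMDiff.mdifferentiable (by simp) x
        have h := DFunLike.congr_fun (mvfderiv_smul (mdifferentiableAt_const (c := r)) hf)
          (L.anchor x (X x))
        rw [mvfderiv_const] at h
        refine h.trans ?_
        simp only [add_apply, ContinuousLinearMap.smulRight_apply,
          zero_apply, zero_smul, add_zero]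
        rfl }
    fun f g => by
      ext x
      have hf := f.contMDiff.mdifferentiable (by simp) x
      have hg := g.contMDiff.mdifferentiable (by simp) x
      exact DFunLike.congr_fun (mvfderiv_mul hf hg) (L.anchor x (X x))

theorem act_congr {f g : C^∞⟮𝓡 m, M; ℝ⟯} {x₀ : M} (h : ∀ᶠ x in 𝓝 x₀, f x = g x)
    (X : Sec m F A) : L.act X f x₀ = L.act X g x₀ := by
  have h' : mvfderiv (𝓡 m) f x₀ = mvfderiv (𝓡 m) g x₀ := by
    have h1 : (f : M → ℝ) =ᶠ[𝓝 x₀] g := h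
    ext v
    simp only [mvfderiv, h1.mfderiv_eq]
    rfl
  exact DFunLike.congr_fun h' (L.anchor x₀ (X x₀))

theorem bracket_smulSec_apply (X Y : Sec m F A) (f : C^∞⟮𝓡 m, M; ℝ⟯) (x : M) :
    L.bracket X (smulSec f Y) x = f x • L.bracket X Y x + L.act X f x • Y x := by
  rw [L.leibniz]; rfl

/-- The bracket is a local operation. -/
theorem bracket_congr [T2Space M] {Y Z : Sec m F A} {x₀ : M} (h : ∀ᶠ x in 𝓝 x₀, Y x = Z x)
    (X : Sec m F A) : L.bracket X Y x₀ = L.bracket X Z x₀ := by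
  obtain ⟨χ, hχ, hχ1⟩ := exists_cutoff (m := m) h
  -- `Y - Z` vanishes wherever `χ ≠ 0`. Both `1 - χ` and `Y - Z` vanish at `x₀`, so both terms of
  -- the Leibniz rule do as well.
  have h1 : smulSec (1 - χ) (Y - Z) = Y - Z := by
    ext x
    change (1 - χ x) • (Y x - Z x) = Y x - Z x
    by_cases hx : χ x = 0
    · rw [hx, sub_zero, one_smul]
    · have : Y x = Z x := hχ (subset_tsupport _ hx)
      rw [this, sub_self, smul_zero]
  have h2 := L.bracket_smulSec_apply X (Y - Z) (1 - χ) x₀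
  have h3 : (1 - χ) x₀ = 0 := by
    change 1 - χ x₀ = 0
    rw [hχ1.self_of_nhds, sub_self]
  have h4 : (Y - Z) x₀ = 0 := by
    change Y x₀ - Z x₀ = 0
    rw [h.self_of_nhds, sub_self]
  rw [h1, h3, h4, zero_smul, smul_zero, add_zero, map_sub] at h2
  exact sub_eq_zero.1 h2

end LieAlgebroid

theorem sec_sum_apply {ι : Type*} (s : Finset ι) (X : ι → Sec m F A) (x : M) :
    (∑ i ∈ s, X i) x = ∑ i ∈ s, X i x :=
  (congrFun (map_sum (ContMDiffSection.coeAddHom (𝓡 m) F ∞ A) X s) x).trans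
    (Finset.sum_apply x s _)

theorem repr_continuousLinearMap_apply {ι V : Type*} [Fintype ι] [AddCommGroup V] [Module ℝ V]
    [TopologicalSpace V] (B : Module.Basis ι ℝ V) (T : V →L[ℝ] V) (v : V) (k : ι) :
    B.repr (T v) k = ∑ l, B.repr (T (B l)) k * B.repr v l := by
  have h := congrArg (fun w => B.repr (T w) k) (B.sum_repr v)
  rw [← h]
  simp [mul_comm, -Module.Basis.sum_repr]

/-! ### Nijenhuis torsion and traces of powers -/

namespace LieAlgebroid

variable (L : LieAlgebroid m F A)

/-- The value at `x₀` of `[X, Z]` in terms of the coefficients `f` of `Z` in a local frame `e`. -/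
theorem bracket_apply_of_eventually_eq_sum [T2Space M] {ι : Type*} [Fintype ι] {x₀ : M}
    {e : ι → Sec m F A} {Z : Sec m F A} {f : ι → C^∞⟮𝓡 m, M; ℝ⟯}
    (h : ∀ᶠ x in 𝓝 x₀, Z x = ∑ i, f i x • e i x) (X : Sec m F A) :
    L.bracket X Z x₀ = ∑ i, (f i x₀ • L.bracket X (e i) x₀ + L.act X (f i) x₀ • e i x₀) := by
  have h1 : ∀ᶠ x in 𝓝 x₀, Z x = (∑ i, smulSec (f i) (e i)) x := by
    filter_upwards [h] with x hx
    rw [hx, sec_sum_apply]; rfl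
  rw [L.bracket_congr h1 X, map_sum, sec_sum_apply]
  exact Finset.sum_congr rfl fun i _ => L.bracket_smulSec_apply X (e i) (f i) x₀

/-- Vanishing of the torsion of `N` in the form `(𝓛_{NX} N) Y = N (𝓛_X N) Y`. -/
theorem IsNijenhuis.lieDerivative {L : LieAlgebroid m F A} {N : BundleEnd m F A}
    (hN : L.IsNijenhuis N) (X Y : Sec m F A) (x : M) :
    L.bracket (N.app X) (N.app Y) x - N x (L.bracket (N.app X) Y x) =
      N x (L.bracket X (N.app Y) x - N x (L.bracket X Y x)) := by
  have h : N x (L.bracket (N.app X) Y x + L.bracket X (N.app Y) x - N x (L.bracket X Y x))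
      - L.bracket (N.app X) (N.app Y) x = 0 := DFunLike.congr_fun (hN X Y) x
  rw [← sub_eq_zero.1 h]
  simp only [map_add, map_sub]
  abel

variable [FiniteDimensional ℝ F]

/-- For a Nijenhuis operator, `d_A (Tr Nⁱ⁺² / (i + 2)) = N* d_A (Tr Nⁱ⁺¹ / (i + 1))`. -/
theorem IsNijenhuis.act_trace_pow [T2Space M] {L : LieAlgebroid m F A} {N : BundleEnd m F A}
    (hN : L.IsNijenhuis N) (X : Sec m F A) (i : ℕ) (x₀ : M) :
    ((i : ℝ) + 1) * L.act X (N.pow (i + 2)).trace x₀ =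
      ((i : ℝ) + 2) * L.act (N.app X) (N.pow (i + 1)).trace x₀ := by
  obtain ⟨e, c, hec⟩ := exists_frame m F A x₀
  -- The entries are global functions, so `a` is a matrix over the ring `C^∞(M)`, on which `ρ(X)` is
  -- a derivation; it represents `N` only near `x₀`.
  let a : Matrix _ _ C^∞⟮𝓡 m, M; ℝ⟯ := Matrix.of fun i j => c i (N.app (e j))
  let γ (X : Sec m F A) : Matrix _ _ C^∞⟮𝓡 m, M; ℝ⟯ :=
    Matrix.of fun i j => c i (L.bracket X (e j))
  let ev (x : M) : C^∞⟮𝓡 m, M; ℝ⟯ →+* ℝ := ContMDiffMap.evalRingHom x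
  have htr (k : ℕ) : ∀ᶠ x in 𝓝 x₀, (N.pow k).trace x = (a ^ k).trace x := by
    filter_upwards [hec] with x hx
    obtain ⟨B, hB, hc⟩ := hx
    have h1 : LinearMap.toMatrix B B (N x : A x →ₗ[ℝ] A x) = (ev x).mapMatrix a := by
      ext k l
      rw [LinearMap.toMatrix_apply, hB]
      exact (hc k (N.app (e l))).symm
    have h2 : ((N x ^ k : A x →L[ℝ] A x) : A x →ₗ[ℝ] A x) = (N x : A x →ₗ[ℝ] A x) ^ k := by
      ext v; simp
    change LinearMap.trace ℝ (A x) ((N x ^ k : A x →L[ℝ] A x) : A x →ₗ[ℝ] A x) =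
      ev x (a ^ k).trace
    rw [h2, LinearMap.trace_eq_matrix_trace ℝ B, ← LinearMap.toMatrix_pow, h1, ← map_pow,
      AddMonoidHom.map_trace]
    rfl
  obtain ⟨B, hB, hc⟩ := hec.self_of_nhds
  let a₀ := (ev x₀).mapMatrix a
  let δ (X : Sec m F A) := (ev x₀).mapMatrix (a.map (L.actDerivation X))
  let γ₀ (X : Sec m F A) := (ev x₀).mapMatrix (γ X)
  have hact (X : Sec m F A) (k : ℕ) :
      L.act X (N.pow (k + 1)).trace x₀ = (k + 1) * (a₀ ^ k * δ X).trace := by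
    rw [L.act_congr (htr (k + 1)) X]
    have := congrArg (ev x₀) (derivation_trace_pow (L.actDerivation X) a k)
    refine this.trans ?_
    rw [map_mul, AddMonoidHom.map_trace]
    simp only [a₀, δ, ← map_pow, ← map_mul]
    simp
  have hN₀ (v : A x₀) (k) : B.repr (N x₀ v) k = ∑ l, a₀ k l * B.repr v l := by
    rw [repr_continuousLinearMap_apply]
    refine Finset.sum_congr rfl fun l _ => ?_
    rw [hB]
    exact congrArg (· * _) (hc k (N.app (e l))).symm
  -- The matrix of `𝓛_X N` at `x₀`: expand `N e_j = ∑ a_ij e_i` and apply the Leibniz rule to `[X, N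
  -- e_j]`.
  have hLie (X : Sec m F A) (k j) :
      B.repr (L.bracket X (N.app (e j)) x₀ - N x₀ (L.bracket X (e j) x₀)) k =
        (δ X + γ₀ X * a₀ - a₀ * γ₀ X) k j := by
    have h1 : ∀ᶠ x in 𝓝 x₀, N.app (e j) x = ∑ i, a i j x • e i x := by
      filter_upwards [hec] with x hx
      obtain ⟨B, hB, hc⟩ := hx
      conv_lhs => rw [← B.sum_repr (N.app (e j) x)]
      exact Finset.sum_congr rfl fun i _ => by rw [hB, ← hc]; rfl
    rw [L.bracket_apply_of_eventually_eq_sum h1, map_sub, Finsupp.sub_apply, hN₀]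
    have h2 : B.repr (∑ i, (a i j x₀ • L.bracket X (e i) x₀ + L.act X (a i j) x₀ • e i x₀)) k =
        ∑ i, γ₀ X k i * a₀ i j + δ X k j := by
      simp only [map_sum, map_add, map_smul, Finset.sum_add_distrib, ← hB, Finsupp.add_apply,
        Finsupp.coe_finsetSum, Finset.sum_apply, Finsupp.smul_apply, B.repr_self, ← hc]
      refine congrArg₂ _ (Finset.sum_congr rfl fun i _ => mul_comm _ _) ?_
      simp [Finsupp.single_apply]
      rfl
    rw [h2]
    simp only [Matrix.sub_apply, Matrix.add_apply, Matrix.mul_apply, ← hc]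
    rw [add_comm]
    rfl
  have hB₀ : δ (N.app X) + γ₀ (N.app X) * a₀ - a₀ * γ₀ (N.app X) =
      a₀ * (δ X + γ₀ X * a₀ - a₀ * γ₀ X) := by
    ext k j
    rw [← hLie, hN.lieDerivative, hN₀, Matrix.mul_apply]
    exact Finset.sum_congr rfl fun l _ => by rw [hLie]
  -- By cyclicity, a power of `a₀` times a commutator with `a₀` has trace zero.
  have hcomm (k : ℕ) (g : Matrix _ _ ℝ) (d : Matrix _ _ ℝ) :
      (a₀ ^ k * (d + g * a₀ - a₀ * g)).trace = (a₀ ^ k * d).trace := by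
    have : (a₀ ^ k * (g * a₀)).trace = (a₀ ^ k * (a₀ * g)).trace := by
      rw [← Matrix.mul_assoc, Matrix.trace_mul_comm, ← Matrix.mul_assoc, ← Matrix.mul_assoc,
        ← pow_succ, ← pow_succ']
    rw [Matrix.mul_sub, Matrix.mul_add, Matrix.trace_sub, Matrix.trace_add, this]
    ring
  -- Restore the commutators, replace `𝓛_{NX} N` by `N ∘ 𝓛_X N` through `hB₀`, and let the extra
  -- `a₀` raise the power.
  have key : (a₀ ^ (i + 1) * δ X).trace = (a₀ ^ i * δ (N.app X)).trace := by
    rw [← hcomm (i + 1) (γ₀ X), ← hcomm i (γ₀ (N.app X)), hB₀, ← Matrix.mul_assoc, ← pow_succ]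
  rw [hact X (i + 1), hact (N.app X) i, key]
  push_cast
  ring

end LieAlgebroid

/-! ### The hierarchy of Hamiltonians and vector fields -/

namespace PNAlgebroid

variable (S : PNAlgebroid m F A)

theorem pow_sharp (j : ℕ) (x : M) (α : A x →L[ℝ] ℝ) :
    (S.nijenhuis x ^ j) (S.poisson.sharp x α) =
      S.poisson.sharp x (α.comp (S.nijenhuis x ^ j)) := by
  induction j generalizing α with
  | zero => rfl
  | succ j ih =>
    rw [pow_succ]
    change (S.nijenhuis x ^ j) (S.nijenhuis x (S.poisson.sharp x α)) = _
    rw [S.twist_skew, ih, ← pow_succ, pow_succ']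
    rfl

variable [FiniteDimensional ℝ F]

theorem act_hamiltonian (X : Sec m F A) (i : ℕ) (x : M) :
    S.act X (S.hamiltonian i) x = (1 / (i : ℝ)) * S.act X (S.nijenhuis.pow i).trace x :=
  DFunLike.congr_fun ((S.toLieAlgebroid.actDerivation X).map_smul (1 / (i : ℝ))
    (S.nijenhuis.pow i).trace) x

theorem hamiltonian_one : S.hamiltonian 1 = S.nijenhuis.trace := by
  ext x
  change (1 / ((1 : ℕ) : ℝ)) * LinearMap.trace ℝ (A x)
    ((S.nijenhuis x ^ 1 : A x →L[ℝ] A x) : A x →ₗ[ℝ] A x) = _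
  rw [pow_one, Nat.cast_one, div_one, one_mul]
  rfl

/-- `d_A h_{i+1} = N* d_A h_i` for `i ≥ 1`. -/
theorem diff_hamiltonian_succ [T2Space M] (i : ℕ) (x : M) :
    S.diff (S.hamiltonian (i + 2)) x =
      (S.diff (S.hamiltonian (i + 1)) x).comp (S.nijenhuis x) := by
  have h (X : Sec m F A) : S.diff (S.hamiltonian (i + 2)) x (X x) =
      S.diff (S.hamiltonian (i + 1)) x (S.nijenhuis x (X x)) := by
    have h1 := S.isNijenhuis.act_trace_pow X i x
    have h2 := S.act_hamiltonian X (i + 2) x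
    have h3 := S.act_hamiltonian (S.nijenhuis.app X) (i + 1) x
    refine h2.trans (Eq.trans ?_ h3.symm)
    push_cast
    field_simp
    linarith
  -- The identity `h` concerns values of global sections; those of the frame at `x` form a basis of
  -- the fibre.
  obtain ⟨e, c, hec⟩ := exists_frame m F A x
  obtain ⟨B, hB, -⟩ := hec.self_of_nhds
  refine ContinuousLinearMap.coe_injective (B.ext fun j => ?_)
  rw [hB]
  exact h (e j)

/-- The recursion is iterated down to `h_1 = Tr N`; it cannot start at `hamiltonian 0`, which is
zero because `1 / 0 = 0`. -/
theorem diff_hamiltonian [T2Space M] (i : ℕ) (x : M) :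
    S.diff (S.hamiltonian (i + 1)) x =
      (S.diff S.nijenhuis.trace x).comp (S.nijenhuis x ^ i) := by
  induction i with
  | zero => rw [S.hamiltonian_one]; rfl
  | succ i ih => rw [S.diff_hamiltonian_succ, ih, pow_succ]; rfl

/-- Split `N^{k-1} = N^{k-i} N^{i-1}`: the factor `N^{i-1}` crosses `π♯` and turns `d_A Tr N` into
`d_A h_i`, while `N^{k-i}` stays with `π`. -/
theorem hierarchy_eq_dPoisson [T2Space M] {k i : ℕ} (hi : 1 ≤ i) (hik : i ≤ k) :
    S.hierarchy k = S.dPoisson (S.twistedPoisson (k - i)) (S.hamiltonian i) := by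
  obtain ⟨i, rfl⟩ := Nat.exists_eq_add_of_le' hi
  obtain ⟨l, rfl⟩ := Nat.exists_eq_add_of_le' hik
  ext x
  have hl : l + (i + 1) - (i + 1) = l := by omega
  have hk : l + (i + 1) - 1 = l + i := by omega
  rw [hl, hierarchy, hk]
  change (S.nijenhuis x ^ (l + i)) (-S.poisson.sharp x (S.diff S.nijenhuis.trace x)) =
    -(S.nijenhuis x ^ l) (S.poisson.sharp x (S.diff (S.hamiltonian (i + 1)) x))
  rw [S.diff_hamiltonian, ← S.pow_sharp, map_neg, pow_add]
  rfl

end PNAlgebroid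

end

end PNAlgebroids

theorem mainTheorem5 {m : ℕ} {M : Type*} [TopologicalSpace M] [T2Space M]
    [ChartedSpace (EuclideanSpace ℝ (Fin m)) M] [IsManifold (𝓡 m) ∞ M]
    {F : Type*} [NormedAddCommGroup F] [NormedSpace ℝ F] [FiniteDimensional ℝ F]
    {A : M → Type*} [TopologicalSpace (TotalSpace F A)] [∀ x, TopologicalSpace (A x)]
    [∀ x, AddCommGroup (A x)] [∀ x, Module ℝ (A x)] [∀ x, IsTopologicalAddGroup (A x)]
    [∀ x, ContinuousSMul ℝ (A x)] [FiberBundle F A] [VectorBundle ℝ F A]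
    [ContMDiffVectorBundle ∞ F A (𝓡 m)]
    (S : PNAlgebroids.PNAlgebroid m F A) (k i : ℕ) (hi : 1 ≤ i) (hik : i ≤ k) :
    S.hierarchy k = (S.nijenhuis.pow (k - 1)).app S.modularVectorField ∧
    S.hierarchy k = S.dPoisson (S.twistedPoisson (k - i)) (S.hamiltonian i) ∧
    S.hierarchy k = S.dPoisson (S.twistedPoisson (i - 1)) (S.hamiltonian (k - i + 1)) := by
  refine ⟨rfl, S.hierarchy_eq_dPoisson hi hik, ?_⟩
  -- The second formula is the first one under the reflection `i ↦ k - i + 1` of `{1, …, k}`.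
  have h := S.hierarchy_eq_dPoisson (k := k) (i := k - i + 1) (by omega) (by omega)
  rwa [show k - (k - i + 1) = i - 1 by omega] at h
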